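/- For $n\ge 1$ let $P^{n-1}$ be the uniform probability measure (normalized surface area, i.e. the rotation-invariant probability measure) on the Euclidean unit sphere $\mathbb{S}^{n-1}=\{y\in\mathbb{R}^n:\sum_{i=1}^n y_i^2=1\}$, and write $\|y\|_1=\sum_{i=1}^n|y_i|$. Then there is an integer $N\geq 1$ such that for every integer $n\ge N$, $$P^{n-1}\left\{y\in\mathbb{S}^{n-1}:\ \exp\left(n^{-1/2}\|y\|_1-1\right)<0.82\right\}\ \ge\ 1-\frac1n .$$ -/

import Mathlib

open MeasureTheory

/-- The Euclidean unit sphere in `ℝⁿ`. -/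
abbrev UnitSphere (n : ℕ) : Type :=
  Metric.sphere (0 : EuclideanSpace ℝ (Fin n)) 1

/-- The normalized surface area (rotation invariant probability) measure on the Euclidean unit
sphere of `ℝⁿ`: `Measure.toSphere` applied to Lebesgue measure is the surface area measure, which
is divided by its total mass. -/
noncomputable def sphereProb (n : ℕ) : Measure (UnitSphere n) :=
  ((volume : Measure (EuclideanSpace ℝ (Fin n))).toSphere Set.univ)⁻¹ •
    (volume : Measure (EuclideanSpace ℝ (Fin n))).toSphere

/-- For `1 ≤ n` the normalization is genuine. -/
theorem sphereProb_isProbabilityMeasure (n : ℕ) (hn : 1 ≤ n) :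
    IsProbabilityMeasure (sphereProb n) := by
  have : Nonempty (Fin n) := ⟨⟨0, hn⟩⟩
  refine ⟨?_⟩
  simp only [sphereProb, Measure.smul_apply, smul_eq_mul]
  refine ENNReal.inv_mul_cancel ?_ (measure_ne_top _ _)
  rw [Ne, Measure.measure_univ_eq_zero]
  exact Measure.toSphere_ne_zero _

/-- The norm `‖y‖₁ = ∑ |yᵢ|` of a vector of `ℝⁿ`. -/
noncomputable def l1norm {n : ℕ} (y : EuclideanSpace ℝ (Fin n)) : ℝ :=
  ∑ i, |y i|

open ProbabilityTheory Filter Topology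

/-! The direction of a standard Gaussian vector is uniform on the sphere, so the probability that
`‖y‖₁ ≥ 0.801 √n` is the Gaussian measure of the cone `‖x‖₁ ≥ 0.801 √n ‖x‖`
(`sphereProb_eq_setLIntegral`). On that cone either `∑ |xᵢ| ≥ 0.799 n` or `∑ xᵢ² ≤ (0.799 / 0.801)²
n` (`l1norm_cone_subset`). Since `E|xᵢ| = √(2/π) ≈ 0.798` and `E xᵢ² = 1`, both are large
deviations, exponentially unlikely by Chernoff's bound, hence eventually of total probability at
most `1/n`. Off the cone the exponential is below `exp (-0.199) < 0.82`. -/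

/-- Integration in polar coordinates of a radial function over a cone. -/
theorem setLIntegral_fun_norm_cone {E : Type*} [NormedAddCommGroup E] [NormedSpace ℝ E]
    [MeasurableSpace E] [BorelSpace E] [FiniteDimensional ℝ E] [Nontrivial E]
    (μ : Measure E) [μ.IsAddHaarMeasure] {s : Set (Metric.sphere (0 : E) 1)}
    (hs : MeasurableSet s) {B : Set E} (hB : MeasurableSet B)
    (hsB : ∀ (y : Metric.sphere (0 : E) 1) (r : ℝ), 0 < r → (r • (y : E) ∈ B ↔ y ∈ s))
    {F : ℝ → ENNReal} (hF : Measurable F) :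
    ∫⁻ x in B, F ‖x‖ ∂μ =
      μ.toSphere s * ∫⁻ r : Set.Ioi (0 : ℝ), F r ∂(.volumeIoiPow (Module.finrank ℝ E - 1)) := by
  calc ∫⁻ x in B, F ‖x‖ ∂μ = ∫⁻ x, B.indicator (fun x => F ‖x‖) x ∂μ :=
        (lintegral_indicator hB _).symm
    _ = ∫⁻ x : ({(0)}ᶜ : Set E), B.indicator (fun x => F ‖x‖) x.1 ∂(μ.comap (↑)) := by
      rw [lintegral_subtype_comap (measurableSet_singleton _).compl, restrict_compl_singleton]
    _ = ∫⁻ p : Metric.sphere (0 : E) 1 × Set.Ioi (0 : ℝ), s.indicator 1 p.1 * F p.2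
          ∂μ.toSphere.prod (.volumeIoiPow (Module.finrank ℝ E - 1)) := by
      rw [← μ.measurePreserving_homeomorphUnitSphereProd.lintegral_comp_emb
        (Homeomorph.measurableEmbedding _)]
      refine lintegral_congr fun x => ?_
      have hx : 0 < ‖x.1‖ := norm_pos_iff.2 x.2
      have h := hsB (homeomorphUnitSphereProd E x).1 ‖x.1‖ hx
      rw [homeomorphUnitSphereProd_apply_fst_coe, smul_smul, mul_inv_cancel₀ hx.ne',
        one_smul] at h
      by_cases hxB : x.1 ∈ B
      · simp [hxB, h.1 hxB]
      · simp [hxB, mt h.2 hxB]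
    _ = _ := by
      rw [lintegral_prod_mul (f := s.indicator 1) (g := fun r : Set.Ioi (0 : ℝ) => F r)
        ((measurable_one.indicator hs).aemeasurable)
        (hF.comp measurable_subtype_coe).aemeasurable, lintegral_indicator_one hs]

/-- The standard Gaussian density on `ℝⁿ`. -/
noncomputable def stdGaussianDensity {n : ℕ} (x : EuclideanSpace ℝ (Fin n)) : ENNReal :=
  ∏ i, gaussianPDF 0 1 (x i)

theorem stdGaussianDensity_eq {n : ℕ} (x : EuclideanSpace ℝ (Fin n)) :
    stdGaussianDensity x =
      ENNReal.ofReal ((√(2 * Real.pi))⁻¹ ^ n * Real.exp (-‖x‖ ^ 2 / 2)) := by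
  rw [stdGaussianDensity]
  simp only [gaussianPDF]
  rw [← ENNReal.ofReal_prod_of_nonneg fun i _ => gaussianPDFReal_nonneg _ _ _]
  congr 1
  simp only [gaussianPDFReal, NNReal.coe_one, mul_one, sub_zero, Finset.prod_mul_distrib,
    Finset.prod_const, Finset.card_univ, Fintype.card_fin, ← Real.exp_sum]
  rw [EuclideanSpace.norm_sq_eq, ← Finset.sum_div, Finset.sum_neg_distrib]
  simp

/-- Tensorization of Gaussian integrals. -/
theorem lintegral_prod_mul_stdGaussianDensity {n : ℕ} {g : ℝ → ℝ} (hg0 : ∀ x, 0 ≤ g x)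
    (hg : Integrable g (gaussianReal 0 1)) :
    ∫⁻ x : EuclideanSpace ℝ (Fin n), ENNReal.ofReal (∏ i, g (x i)) * stdGaussianDensity x =
      ENNReal.ofReal (∫ x, g x ∂gaussianReal 0 1) ^ n := by
  have hint : Integrable fun x => gaussianPDFReal 0 1 x * g x := by
    rw [gaussianReal_of_var_ne_zero _ one_ne_zero,
      integrable_withDensity_iff_integrable_smul' (measurable_gaussianPDF 0 1)
        (ae_of_all _ fun x => gaussianPDF_lt_top)] at hg
    simpa [toReal_gaussianPDF] using hg
  have h0 : ∀ x, 0 ≤ gaussianPDFReal 0 1 x * g x :=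
    fun x => mul_nonneg (gaussianPDFReal_nonneg _ _ _) (hg0 x)
  rw [← (PiLp.volume_preserving_toLp (Fin n)).lintegral_comp_emb
    (MeasurableEquiv.toLp 2 (Fin n → ℝ)).measurableEmbedding,
    integral_gaussianReal_eq_integral_smul one_ne_zero]
  simp only [smul_eq_mul]
  rw [← ENNReal.ofReal_pow (integral_nonneg h0)]
  have := integral_fintype_prod_volume_eq_pow (ι := Fin n)
    (fun x : ℝ => gaussianPDFReal 0 1 x * g x)
  rw [Fintype.card_fin] at this
  rw [← this, ofReal_integral_eq_lintegral_ofReal]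
  · refine lintegral_congr fun x => ?_
    simp only [stdGaussianDensity, gaussianPDF]
    rw [← ENNReal.ofReal_prod_of_nonneg fun i _ => gaussianPDFReal_nonneg _ _ _,
      ← ENNReal.ofReal_mul (Finset.prod_nonneg fun i _ => hg0 _), Finset.prod_mul_distrib, mul_comm]
  · exact Integrable.fintype_prod fun _ => hint
  · exact ae_of_all _ fun x => Finset.prod_nonneg fun i _ => h0 _

theorem lintegral_stdGaussianDensity {n : ℕ} :
    ∫⁻ x : EuclideanSpace ℝ (Fin n), stdGaussianDensity x = 1 := by
  simpa using lintegral_prod_mul_stdGaussianDensity (n := n) (g := fun _ => 1)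
    (fun _ => zero_le_one) (integrable_const _)

/-- The uniform measure of a subset of the sphere is the Gaussian measure of the cone over it. -/
theorem sphereProb_eq_setLIntegral {n : ℕ} (hn : 1 ≤ n) {s : Set (UnitSphere n)}
    (hs : MeasurableSet s) {B : Set (EuclideanSpace ℝ (Fin n))} (hB : MeasurableSet B)
    (hsB : ∀ (y : UnitSphere n) (r : ℝ), 0 < r →
      (r • (y : EuclideanSpace ℝ (Fin n)) ∈ B ↔ y ∈ s)) :
    sphereProb n s = ∫⁻ x in B, stdGaussianDensity x := by
  have : Nonempty (Fin n) := ⟨⟨0, hn⟩⟩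
  set F : ℝ → ENNReal := fun r =>
    ENNReal.ofReal ((√(2 * Real.pi))⁻¹ ^ n * Real.exp (-r ^ 2 / 2))
  have hF : Measurable F := by fun_prop
  -- The whole space serves to identify the radial integral as the inverse of the total surface
  -- area.
  have h1 := setLIntegral_fun_norm_cone volume MeasurableSet.univ
    (B := (Set.univ : Set (EuclideanSpace ℝ (Fin n)))) MeasurableSet.univ (by simp) hF
  have h2 := setLIntegral_fun_norm_cone volume hs hB hsB hF
  simp only [F, ← stdGaussianDensity_eq] at h1 h2
  rw [Measure.restrict_univ, lintegral_stdGaussianDensity] at h1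
  rw [h2, sphereProb, Measure.smul_apply, smul_eq_mul, mul_comm]
  congr 1
  exact (ENNReal.eq_inv_of_mul_eq_one_left (by rw [mul_comm]; exact h1.symm)).symm

/-- Chernoff's bound for sums of functions of independent standard Gaussian variables. -/
theorem setLIntegral_stdGaussianDensity_le_mgf_pow {n : ℕ} {Y : ℝ → ℝ} (hY : Measurable Y)
    {t : ℝ} (ht : 0 ≤ t) (hint : t ∈ integrableExpSet Y (gaussianReal 0 1)) :
    ∫⁻ x in {x : EuclideanSpace ℝ (Fin n) | 0 ≤ ∑ i, Y (x i)}, stdGaussianDensity x ≤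
      ENNReal.ofReal (mgf Y (gaussianReal 0 1) t ^ n) := by
  rw [ENNReal.ofReal_pow mgf_nonneg, mgf,
    ← lintegral_prod_mul_stdGaussianDensity (fun x => (Real.exp_pos _).le) hint,
    ← lintegral_indicator (measurableSet_le measurable_const (by fun_prop))]
  -- Markov's inequality: on the event, `1 ≤ exp (t * ∑ Y (x i))`.
  refine lintegral_mono (Set.indicator_le fun x hx => ?_)
  rw [← Real.exp_sum, ← Finset.mul_sum]
  refine le_mul_of_one_le_left zero_le ?_
  rw [ENNReal.one_le_ofReal]
  exact Real.one_le_exp (mul_nonneg ht hx)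

/-- The moment generating function equals 1 at 0 and has derivative `E Y < 0` there, so it drops
below 1 just to the right. -/
theorem exists_mgf_lt_one {Ω : Type*} [MeasurableSpace Ω] {μ : Measure Ω}
    [IsProbabilityMeasure μ] {Y : Ω → ℝ} (h : 0 ∈ interior (integrableExpSet Y μ))
    (hmean : ∫ ω, Y ω ∂μ < 0) :
    ∃ t, 0 ≤ t ∧ t ∈ integrableExpSet Y μ ∧ mgf Y μ t < 1 := by
  have hd := hasDerivAt_mgf h
  simp only [zero_mul, Real.exp_zero, mul_one] at hd
  have h1 := (hasDerivAt_iff_tendsto_slope_zero.1 hd).mono_left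
    (nhdsWithin_mono 0 (s := Set.Ioi 0) fun x hx => ne_of_gt hx)
  have h2 : ∀ᶠ t in 𝓝[>] (0 : ℝ), t ∈ integrableExpSet Y μ :=
    nhdsWithin_le_nhds (mem_interior_iff_mem_nhds.1 h)
  obtain ⟨t, ⟨h3, h4⟩, h5⟩ := ((h1.eventually_lt_const hmean).and h2).and
    self_mem_nhdsWithin |>.exists
  refine ⟨t, le_of_lt h5, h4, ?_⟩
  have h5 : 0 < t := h5
  simp only [zero_add, mgf_zero, smul_eq_mul] at h3
  exact sub_neg.1 (neg_of_mul_neg_right h3 (inv_pos.2 h5).le)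

/-- Exponential decay of the large deviation probabilities of Gaussian sums. -/
theorem exists_setLIntegral_stdGaussianDensity_le_pow {Y : ℝ → ℝ} (hY : Measurable Y)
    (h : 0 ∈ interior (integrableExpSet Y (gaussianReal 0 1)))
    (hmean : ∫ x, Y x ∂gaussianReal 0 1 < 0) :
    ∃ ρ : ℝ, 0 ≤ ρ ∧ ρ < 1 ∧ ∀ n : ℕ,
      ∫⁻ x in {x : EuclideanSpace ℝ (Fin n) | 0 ≤ ∑ i, Y (x i)}, stdGaussianDensity x ≤
        ENNReal.ofReal (ρ ^ n) := by
  obtain ⟨t, ht, hint, hlt⟩ := exists_mgf_lt_one h hmean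
  exact ⟨_, mgf_nonneg, hlt, fun n => setLIntegral_stdGaussianDensity_le_mgf_pow hY ht hint⟩

theorem integral_abs_gaussianReal : ∫ x, |x| ∂gaussianReal 0 1 = √(2 / Real.pi) := by
  rw [integral_gaussianReal_eq_integral_smul one_ne_zero]
  have h1 : ∀ x : ℝ, gaussianPDFReal 0 1 x • |x| =
      (√(2 * Real.pi))⁻¹ * (|x| * Real.exp (-(1 / 2) * |x| ^ 2)) := by
    intro x
    simp only [gaussianPDFReal, NNReal.coe_one, sub_zero, smul_eq_mul, sq_abs, mul_one]
    rw [show -x ^ 2 / 2 = -(1 / 2) * x ^ 2 by ring]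
    ring
  simp only [h1]
  rw [integral_const_mul, integral_comp_abs (f := fun x => x * Real.exp (-(1 / 2) * x ^ 2))]
  have h2 := integral_rpow_mul_exp_neg_mul_rpow (p := 2) (q := 1) (b := 1 / 2)
    (by norm_num) (by norm_num) (by norm_num)
  norm_num [Real.rpow_neg_one] at h2
  norm_num
  rw [h2]
  have hpi := Real.pi_pos
  field_simp
  rw [Real.sq_sqrt zero_le_two]

theorem zero_mem_interior_integrableExpSet_abs_sub (a : ℝ) :
    0 ∈ interior (integrableExpSet (fun x => |x| - a) (gaussianReal 0 1)) := by
  suffices integrableExpSet (fun x => |x| - a) (gaussianReal 0 1) = Set.univ by simp [this]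
  refine Set.eq_univ_of_forall fun t => ?_
  have h : Integrable (fun x => Real.exp (t * |x|)) (gaussianReal 0 1) :=
    integrable_exp_mul_abs (integrable_exp_mul_gaussianReal t)
      (integrable_exp_mul_gaussianReal (-t))
  simpa [integrableExpSet, mul_sub, Real.exp_sub] using h.div_const (Real.exp (t * a))

/-- Against the Gaussian density the exponent becomes `-(1/2 + t) x²` plus a constant, which is
integrable for `t > -1/2`. -/
theorem zero_mem_interior_integrableExpSet_sub_sq (b : ℝ) :
    0 ∈ interior (integrableExpSet (fun x => b - x ^ 2) (gaussianReal 0 1)) := by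
  rw [mem_interior_iff_mem_nhds]
  filter_upwards [lt_mem_nhds (show (-(1 / 2) : ℝ) < 0 by norm_num)] with t ht
  have h := (integrable_exp_neg_mul_sq (b := 1 / 2 + t) (by linarith)).const_mul
    ((√(2 * Real.pi))⁻¹ * Real.exp (t * b))
  simp only [integrableExpSet, Set.mem_ofPred_eq]
  rw [gaussianReal_of_var_ne_zero _ one_ne_zero,
    integrable_withDensity_iff_integrable_smul' (measurable_gaussianPDF 0 1)
      (ae_of_all _ fun x => gaussianPDF_lt_top)]
  refine h.congr (ae_of_all _ fun x => ?_)
  simp only [toReal_gaussianPDF, gaussianPDFReal, NNReal.coe_one, sub_zero, smul_eq_mul, mul_one]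
  rw [mul_assoc, mul_assoc, ← Real.exp_add, ← Real.exp_add]
  ring_nf

theorem integral_sq_gaussianReal : ∫ x, x ^ 2 ∂gaussianReal 0 1 = 1 := by
  have h := variance_id_gaussianReal (μ := 0) (v := 1)
  rw [variance_of_integral_eq_zero aemeasurable_id (by simp)] at h
  simpa using h

theorem integrable_of_zero_mem_interior_integrableExpSet {Ω : Type*} [MeasurableSpace Ω]
    {μ : Measure Ω} {Y : Ω → ℝ} (h : 0 ∈ interior (integrableExpSet Y μ)) : Integrable Y μ := by
  simpa using integrable_pow_of_mem_interior_integrableExpSet h 1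

theorem integral_abs_sub_gaussianReal_neg :
    ∫ x, (|x| - 0.799) ∂gaussianReal 0 1 < 0 := by
  have hi : Integrable (fun x : ℝ => |x|) (gaussianReal 0 1) := by
    simpa using integrable_of_zero_mem_interior_integrableExpSet
      (zero_mem_interior_integrableExpSet_abs_sub 0)
  rw [integral_sub hi (integrable_const _), integral_abs_gaussianReal]
  have : √(2 / Real.pi) < 0.799 := by
    rw [Real.sqrt_lt' (by norm_num), div_lt_iff₀ Real.pi_pos]
    -- `2 / 3.14 < 0.637 < 0.799²`.
    nlinarith [Real.pi_gt_d2]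
  simpa using this

theorem integral_sub_sq_gaussianReal_neg {b : ℝ} (hb : b < 1) :
    ∫ x, (b - x ^ 2) ∂gaussianReal 0 1 < 0 := by
  have hi : Integrable (fun x : ℝ => x ^ 2) (gaussianReal 0 1) := by
    simpa using (integrable_of_zero_mem_interior_integrableExpSet
      (zero_mem_interior_integrableExpSet_sub_sq 0)).neg
  rw [integral_sub (integrable_const _) hi, integral_sq_gaussianReal]
  simpa using hb

theorem measurable_l1norm {n : ℕ} : Measurable (l1norm (n := n)) := by
  unfold l1norm
  fun_prop

theorem measurableSet_le_l1norm {n : ℕ} (a : ℝ) :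
    MeasurableSet {y : UnitSphere n | a ≤ l1norm (y : EuclideanSpace ℝ (Fin n))} :=
  measurableSet_le measurable_const (measurable_l1norm.comp measurable_subtype_coe)

theorem l1norm_smul {n : ℕ} {r : ℝ} (hr : 0 ≤ r) (x : EuclideanSpace ℝ (Fin n)) :
    l1norm (r • x) = r * l1norm x := by
  simp [l1norm, abs_mul, abs_of_nonneg hr, Finset.mul_sum]

/-- A vector whose `ℓ¹` norm is large relative to its Euclidean norm has a large `ℓ¹` norm or a
small Euclidean norm. -/
theorem l1norm_cone_subset {n : ℕ} {a c : ℝ} (hc : 0 < c) :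
    {x : EuclideanSpace ℝ (Fin n) | c * √n * ‖x‖ ≤ l1norm x} ⊆
      {x | 0 ≤ ∑ i, (|x i| - a)} ∪ {x | 0 ≤ ∑ i, ((a / c) ^ 2 - x i ^ 2)} := by
  intro x hx
  simp only [Set.mem_union, Set.mem_ofPred_eq, Finset.sum_sub_distrib, Finset.sum_const,
    Finset.card_univ, Fintype.card_fin, nsmul_eq_mul, sub_nonneg] at hx ⊢
  by_contra! h
  obtain ⟨h1, h2⟩ := h
  have h3 : ‖x‖ ^ 2 = ∑ i, x i ^ 2 := by simp [EuclideanSpace.norm_sq_eq]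
  rw [← h3] at h2
  have h4 : √n * (a / c) < ‖x‖ := by
    refine lt_of_pow_lt_pow_left₀ 2 (norm_nonneg _) ?_
    rwa [mul_pow, Real.sq_sqrt (Nat.cast_nonneg _)]
  have h5 : c * √n * (√n * (a / c)) ≤ c * √n * ‖x‖ := by gcongr
  have h6 : c * √n * (√n * (a / c)) = n * a := by
    field_simp
    rw [Real.sq_sqrt (Nat.cast_nonneg _), mul_comm]
  have h7 : l1norm x < n * a := h1
  linarith

theorem exp_neg_lt : Real.exp (-0.199) < 0.82 := by
  -- The cubic Taylor polynomial at 0.199 is about 1.2201, just above `1 / 0.82 ≈ 1.2195`.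
  have h := Real.sum_le_exp_of_nonneg (x := 0.199) (by norm_num) 4
  norm_num [Finset.sum_range_succ, Nat.factorial] at h
  rw [Real.exp_neg, inv_lt_comm₀ (Real.exp_pos _) (by norm_num)]
  norm_num
  linarith

theorem sphereProb_l1norm_ge_le :
    ∃ ρ₁ ρ₂ : ℝ, 0 ≤ ρ₁ ∧ ρ₁ < 1 ∧ 0 ≤ ρ₂ ∧ ρ₂ < 1 ∧ ∀ n : ℕ, 1 ≤ n →
      sphereProb n {y : UnitSphere n | 0.801 * √n ≤ l1norm (y : EuclideanSpace ℝ (Fin n))} ≤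
        ENNReal.ofReal (ρ₁ ^ n + ρ₂ ^ n) := by
  obtain ⟨ρ₁, h10, h11, h1⟩ := exists_setLIntegral_stdGaussianDensity_le_pow (by fun_prop)
    (zero_mem_interior_integrableExpSet_abs_sub 0.799) integral_abs_sub_gaussianReal_neg
  obtain ⟨ρ₂, h20, h21, h2⟩ := exists_setLIntegral_stdGaussianDensity_le_pow (by fun_prop)
    (zero_mem_interior_integrableExpSet_sub_sq ((0.799 / 0.801) ^ 2))
    (integral_sub_sq_gaussianReal_neg (by norm_num))
  refine ⟨ρ₁, ρ₂, h10, h11, h20, h21, fun n hn => ?_⟩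
  rw [sphereProb_eq_setLIntegral hn (measurableSet_le_l1norm _)
    (B := {x | 0.801 * √n * ‖x‖ ≤ l1norm x})
    (measurableSet_le (by fun_prop) measurable_l1norm)]
  · grw [l1norm_cone_subset (a := 0.799) (by norm_num), lintegral_union_le, h1 n,
      h2 n, ENNReal.ofReal_add (by positivity) (by positivity)]
  · intro y r hr
    have hy : ‖(y : EuclideanSpace ℝ (Fin n))‖ = 1 := by simp
    simp only [Set.mem_ofPred_eq, l1norm_smul hr.le, norm_smul, hy, Real.norm_of_nonneg hr.le]
    rw [mul_one, mul_comm _ r, mul_le_mul_iff_right₀ hr]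

theorem theorem2 :
    ∃ N : ℕ, ∀ n : ℕ, N ≤ n →
      1 - 1 / (n : ℝ) ≤
        (sphereProb n).real
          {y : UnitSphere n |
            Real.exp ((n : ℝ) ^ (-(1 / 2) : ℝ) * l1norm (y : EuclideanSpace ℝ (Fin n)) - 1)
              < 0.82} := by
  obtain ⟨ρ₁, ρ₂, h10, h11, h20, h21, h⟩ := sphereProb_l1norm_ge_le
  -- Geometric decay beats `1/n`: `n (ρ₁ ^ n + ρ₂ ^ n)` tends to 0.
  have hlim := (tendsto_self_mul_const_pow_of_lt_one h10 h11).add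
    (tendsto_self_mul_const_pow_of_lt_one h20 h21)
  rw [add_zero] at hlim
  obtain ⟨N, hN⟩ := eventually_atTop.1 (hlim.eventually_le_const one_pos)
  refine ⟨max N 1, fun n hn => ?_⟩
  have hn1 : 1 ≤ n := le_of_max_le_right hn
  have hn0 : (0 : ℝ) < n := by exact_mod_cast hn1
  have := sphereProb_isProbabilityMeasure n hn1
  set B : Set (UnitSphere n) := {y | 0.801 * √n ≤ l1norm (y : EuclideanSpace ℝ (Fin n))}
  have hB : MeasurableSet B := measurableSet_le_l1norm _
  have h1 : (sphereProb n).real B ≤ 1 / n := by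
    refine (ENNReal.toReal_le_of_le_ofReal (by positivity) (h n hn1)).trans ?_
    rw [le_div_iff₀ hn0]
    have := hN n (le_of_max_le_left hn)
    linarith
  calc 1 - 1 / (n : ℝ) ≤ 1 - (sphereProb n).real B := by linarith
    _ = (sphereProb n).real Bᶜ := (probReal_compl_eq_one_sub hB).symm
    _ ≤ _ := by
      refine measureReal_mono fun y hy => ?_
      have hy : l1norm (y : EuclideanSpace ℝ (Fin n)) < 0.801 * √n := not_le.1 hy
      refine lt_trans (Real.exp_lt_exp.2 ?_) exp_neg_lt
      have h2 : (n : ℝ) ^ (-(1 / 2) : ℝ) * l1norm (y : EuclideanSpace ℝ (Fin n)) < 0.801 := by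
        rwa [Real.rpow_neg hn0.le, ← Real.sqrt_eq_rpow, inv_mul_lt_iff₀ (Real.sqrt_pos.2 hn0),
          mul_comm]
      linarith
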